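/- Let $d\ge 0$, let $\phi$ be an invertible linear map on $\mathbb{R}^d$ and let $\mu$ be a Borel probability measure on $\mathbb{R}^d$ (the common law of a stationary noise process). For Borel probability measures, $*$ denotes convolution, $\phi(\rho)$ the image of $\rho$ under $\phi$, $\delta_x$ the Dirac measure at $x$, $\prod$ a convolution product, and convergence is weak convergence. Let $C(\phi)=\{v\in\mathbb{R}^d : \phi^n(v)\to 0 \text{ as } n\to\infty\}$ be the contraction subspace of $\phi$. Consider the equation $$\lambda_k=\mu*\phi(\lambda_{k-1}),\qquad k\in\mathbb{Z}, \tag{4}$$ whose solutions are bi-sequences $(\lambda_k)_{k\in\mathbb{Z}}$ of Borel probability measures on $\mathbb{R}^d$. A solution $(\lambda_k)$ is called fundamental if for each solution $(\lambda'_k)$ there is a Borel probability measure $\rho$ on $\mathbb{R}^d$ such that $\lambda'_k=\lambda_k*\phi^k(\rho)$ for all $k\in\mathbb{Z}$. A probability measure $\rho$ is called strongly $\phi$-decomposable with co-factor $\sigma$ if $\rho=\sigma*\phi(\rho)$ and $\phi^n(\rho)\to\delta_0$. Then the following are equivalent: 1. equation (4) has a solution; 2. equation (4) has a fundamental solution;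 3. $\mu$ is supported on a coset $u+C(\phi)$ for some $u\in\mathbb{R}^d$ (that is, $\mu(u+C(\phi))=1$), and $\int\log(\|v\|+1)\,d\mu(v)<\infty$. In this case, let $u$ be any vector as in 3. For each $y\in\mathbb{R}^d$ there is a bi-sequence $(u_k)_{k\in\mathbb{Z}}$ in $\mathbb{R}^d$ with $u_0=y$ and $u_k=u+\phi(u_{k-1})$ for all $k\in\mathbb{Z}$. There is a unique strongly $\phi$-decomposable probability measure $\nu$ with co-factor $\mu*\delta_{-u}$, and $$\nu=\mu*\delta_{-u}*\phi(\nu)=\lim_{k\to\infty}\prod_{i=1}^{k}\phi^{i-1}(\mu*\delta_{-u}).$$ For every bi-sequence $(u_k)_{k\in\mathbb{Z}}$ with $u_k=u+\phi(u_{k-1})$ for all $k\in\mathbb{Z}$, $(\nu*\delta_{u_k})_{k\in\mathbb{Z}}$ is a fundamental solution of (4); if moreover $u_0\in C(\phi)$ (for example $u_0=0$), then also $$\nu=\lim_{k\to\infty}\Big(\prod_{i=1}^{k}\phi^{i-1}(\mu)\Big)*\delta_{-u_k}.$$ -/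

import Mathlib

open MeasureTheory Filter Topology
open scoped ENNReal Pointwise

noncomputable section

namespace ConvEq

/-- The image `T(ρ)` of a Borel probability measure under a continuous linear map. -/
def push {E : Type*} [NormedAddCommGroup E] [NormedSpace ℝ E] [MeasurableSpace E] [BorelSpace E]
    (T : E →L[ℝ] E) (ρ : ProbabilityMeasure E) : ProbabilityMeasure E :=
  ρ.map (f := T) T.continuous.measurable.aemeasurable

/-- The convolution `ρ * σ` of two Borel probability measures. -/
def conv {E : Type*} [NormedAddCommGroup E] [MeasurableSpace E] [BorelSpace E]
    [SecondCountableTopology E] (ρ σ : ProbabilityMeasure E) : ProbabilityMeasure E :=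
  ⟨Measure.conv (ρ : Measure E) (σ : Measure E), inferInstance⟩

/-- The Dirac measure `δ_x`. -/
def delta {E : Type*} [MeasurableSpace E] (x : E) : ProbabilityMeasure E :=
  ⟨Measure.dirac x, inferInstance⟩

/-- The convolution product `∏_{i=1}^{n} T^{i-1}(ρ) = ρ * T(ρ) * ⋯ * T^{n-1}(ρ)`
(which is `δ_0` for `n = 0`). -/
def convProd {E : Type*} [NormedAddCommGroup E] [NormedSpace ℝ E] [MeasurableSpace E]
    [BorelSpace E] [SecondCountableTopology E] (T : E →L[ℝ] E) (ρ : ProbabilityMeasure E) :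
    ℕ → ProbabilityMeasure E
  | 0 => delta 0
  | n + 1 => conv (convProd T ρ n) (push (T ^ n) ρ)

/-- `(lam k)` solves `lam k = μ k * φ(lam (k - 1))` for all integers `k`. -/
def IsSolution {E : Type*} [NormedAddCommGroup E] [NormedSpace ℝ E] [MeasurableSpace E]
    [BorelSpace E] [SecondCountableTopology E] (φ : E ≃L[ℝ] E)
    (μ lam : ℤ → ProbabilityMeasure E) : Prop :=
  ∀ k : ℤ, lam k = conv (μ k) (push (φ : E →L[ℝ] E) (lam (k - 1)))

/-- A solution `(lam k)` is fundamental if every solution is of the form `lam k * φ^k(ρ)` for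
some probability measure `ρ`. The power `φ ^ k` is taken in the group of linear automorphisms. -/
def IsFundamentalSolution {E : Type*} [NormedAddCommGroup E] [NormedSpace ℝ E] [MeasurableSpace E]
    [BorelSpace E] [SecondCountableTopology E] (φ : E ≃L[ℝ] E)
    (μ lam : ℤ → ProbabilityMeasure E) : Prop :=
  IsSolution φ μ lam ∧
    ∀ lam' : ℤ → ProbabilityMeasure E, IsSolution φ μ lam' →
      ∃ ρ : ProbabilityMeasure E, ∀ k : ℤ,
        lam' k = conv (lam k) (push ((φ ^ k : E ≃L[ℝ] E) : E →L[ℝ] E) ρ)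

/-- `ρ` is strongly `T`-decomposable with co-factor `σ`: `ρ = σ * T(ρ)` and `T^n(ρ) → δ_0`
weakly. -/
def IsStronglyDecomposable {E : Type*} [NormedAddCommGroup E] [NormedSpace ℝ E]
    [MeasurableSpace E] [BorelSpace E] [SecondCountableTopology E] (T : E →L[ℝ] E)
    (σ ρ : ProbabilityMeasure E) : Prop :=
  ρ = conv σ (push T ρ) ∧ Tendsto (fun n : ℕ => push (T ^ n) ρ) atTop (𝓝 (delta 0))

/-- The contraction subspace `C(T) = {v | T^n v → 0}`. -/
def contractionSubspace {E : Type*} [NormedAddCommGroup E] [NormedSpace ℝ E] (T : E →L[ℝ] E) :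
    Submodule ℝ E where
  carrier := {v | Tendsto (fun n : ℕ => (T ^ n) v) atTop (𝓝 0)}
  add_mem' {a b} ha hb := by
    have ha' : Tendsto (fun n : ℕ => (T ^ n) a) atTop (𝓝 0) := ha
    have hb' : Tendsto (fun n : ℕ => (T ^ n) b) atTop (𝓝 0) := hb
    change Tendsto (fun n : ℕ => (T ^ n) (a + b)) atTop (𝓝 0)
    simpa only [map_add, add_zero] using ha'.add hb'
  zero_mem' := by
    change Tendsto (fun n : ℕ => (T ^ n) (0 : E)) atTop (𝓝 0)
    simp only [map_zero, tendsto_const_nhds]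
  smul_mem' c v hv := by
    have hv' : Tendsto (fun n : ℕ => (T ^ n) v) atTop (𝓝 0) := hv
    change Tendsto (fun n : ℕ => (T ^ n) (c • v)) atTop (𝓝 0)
    simpa only [map_smul, smul_zero] using hv'.const_smul c

/-- `μ` is supported on the coset `u + C(T)` and `∫ log(‖v‖ + 1) dμ(v) < ∞`. -/
def CosetAndLogMoment {E : Type*} [NormedAddCommGroup E] [NormedSpace ℝ E] [MeasurableSpace E]
    (T : E →L[ℝ] E) (μ : ProbabilityMeasure E) (u : E) : Prop :=
  (μ : Measure E) (u +ᵥ (contractionSubspace T : Set E)) = 1 ∧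
    ∫⁻ v, ENNReal.ofReal (Real.log (‖v‖ + 1)) ∂(μ : Measure E) < ∞

end ConvEq

end

/-! Necessity: iterating (4) makes every product μ * φ(μ) * ⋯ * φ^(n-1)(μ) a convolution factor of
the single law λ_0. Near 0 the characteristic function of λ_0 stays away from 0, which bounds ∑ (1 -
|μ̂ ∘ (φ^i)*|²) along each ray; a doubling inequality and a truncation inequality turn this into
summability of the masses of {‖φ^i x‖ > r} under the symmetrization of μ. By Tonelli almost every u
serves as a centering for μ itself. Borel–Cantelli then gives φ^i(x - u) → 0 almost surely, and
counting the i with ‖φ^i(x - u)‖ > 1 gives the logarithmic moment, since φ⁻¹ is bounded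
(`exists_tsum_norm_gt_ne_top`, `ofReal_log_norm_le_tsum`).

Sufficiency: after centering by u the noise lives on C(φ), where φ^n decays geometrically, and the
logarithmic moment rules out exponentially large noise. Hence the i.i.d. series ∑ φ^i(ω_i) converges
almost surely, and ν is its law (`exists_tendsto_convProd`).

Fundamentality: for the centered equation the remainders φ^n(λ_{-n}) are tight because the
complementary factors converge; a cluster point is the required ρ (`exists_eq_conv_push_zpow`).
Shifting by an orbit of v ↦ u + φ(v) returns to the original equation. -/

namespace ConvEq

/-! ### Images under continuous linear maps -/

section Push

variable {E : Type*} [NormedAddCommGroup E] [NormedSpace ℝ E] [MeasurableSpace E] [BorelSpace E]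

theorem push_push (S T : E →L[ℝ] E) (ρ : ProbabilityMeasure E) :
    push S (push T ρ) = push (S * T) ρ :=
  Subtype.ext (Measure.map_map S.continuous.measurable T.continuous.measurable)

theorem push_one (ρ : ProbabilityMeasure E) : push (1 : E →L[ℝ] E) ρ = ρ :=
  Subtype.ext Measure.map_id

theorem push_delta (T : E →L[ℝ] E) (x : E) : push T (delta x) = delta (T x) :=
  Subtype.ext (Measure.map_dirac' T.continuous.measurable x)

theorem tendsto_push {ι : Type*} {l : Filter ι} {a : ι → ProbabilityMeasure E}
    {α : ProbabilityMeasure E} (T : E →L[ℝ] E) (ha : Tendsto a l (𝓝 α)) :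
    Tendsto (fun i => push T (a i)) l (𝓝 (push T α)) :=
  ((ProbabilityMeasure.continuous_map T.continuous).tendsto α).comp ha

end Push

/-! ### Convolution: algebra, continuity, tightness of factors, iteration of the equation -/

section Algebra

variable {E : Type*} [NormedAddCommGroup E] [MeasurableSpace E] [BorelSpace E]
  [SecondCountableTopology E]

theorem conv_comm (ρ σ : ProbabilityMeasure E) : conv ρ σ = conv σ ρ :=
  Subtype.ext (Measure.conv_comm _ _)

theorem conv_assoc (ρ σ τ : ProbabilityMeasure E) :
    conv (conv ρ σ) τ = conv ρ (conv σ τ) :=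
  Subtype.ext (Measure.conv_assoc _ _ _)

instance : Std.Commutative (conv (E := E)) := ⟨conv_comm⟩

instance : Std.Associative (conv (E := E)) := ⟨conv_assoc⟩

theorem conv_delta_zero (ρ : ProbabilityMeasure E) : conv ρ (delta 0) = ρ :=
  Subtype.ext (Measure.conv_dirac_zero _)

theorem conv_delta_delta (x y : E) : conv (delta x) (delta y) = delta (x + y) :=
  Subtype.ext (Measure.dirac_conv_dirac _ _)

theorem conv_eq_map (ρ σ : ProbabilityMeasure E) :
    conv ρ σ = (ρ.prod σ).map (f := fun p : E × E => p.1 + p.2)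
      (continuous_add.measurable.aemeasurable) :=
  Subtype.ext rfl

theorem continuous_conv :
    Continuous (fun p : ProbabilityMeasure E × ProbabilityMeasure E => conv p.1 p.2) := by
  simp only [conv_eq_map]
  exact (ProbabilityMeasure.continuous_map continuous_add).comp ProbabilityMeasure.continuous_prod

theorem tendsto_conv {ι : Type*} {l : Filter ι} {a b : ι → ProbabilityMeasure E}
    {α β : ProbabilityMeasure E} (ha : Tendsto a l (𝓝 α)) (hb : Tendsto b l (𝓝 β)) :
    Tendsto (fun i => conv (a i) (b i)) l (𝓝 (conv α β)) :=
  (continuous_conv.tendsto (α, β)).comp (ha.prodMk_nhds hb)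

theorem tendsto_delta {ι : Type*} {l : Filter ι} {a : ι → E} {x : E}
    (ha : Tendsto a l (𝓝 x)) : Tendsto (fun i => delta (a i)) l (𝓝 (delta x)) := by
  rw [ProbabilityMeasure.tendsto_iff_forall_integral_tendsto]
  intro f
  simpa [delta, Function.comp_def] using (f.continuous.tendsto x).comp ha

/-- If x ∈ K₁ and x + y ∈ K₂, then y = (x + y) - x ∈ K₂ - K₁; so x ∈ K₁ and y ∉ K₂ - K₁ force x + y
∉ K₂. -/
theorem measure_mul_measure_compl_sub_le {α β γ : ProbabilityMeasure E} (h : conv α β = γ)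
    {K₁ K₂ : Set E} (hK₂ : IsCompact K₂) :
    (α : Measure E) K₁ * (β : Measure E) (K₂ - K₁)ᶜ ≤ (γ : Measure E) K₂ᶜ := by
  rw [← h]
  change _ ≤ Measure.map (fun p : E × E => p.1 + p.2) _ _
  rw [Measure.map_apply (by fun_prop) hK₂.measurableSet.compl, ← Measure.prod_prod]
  refine measure_mono ?_
  rintro ⟨x, y⟩ ⟨hx, hy⟩ hxy
  exact hy ⟨x + y, hxy, x, hx, by simp⟩

/-- Some compact K₁ carries at least half of the mass of every `a n`, since a convergent sequence is
tight. With K₂ nearly carrying γ, the compact set K₂ - K₁ then nearly carries every `b n`. -/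
theorem isTightMeasureSet_of_conv_eq [CompleteSpace E] {a b : ℕ → ProbabilityMeasure E}
    {α γ : ProbabilityMeasure E} (ha : Tendsto a atTop (𝓝 α)) (h : ∀ n, conv (a n) (b n) = γ) :
    IsTightMeasureSet {((μ : ProbabilityMeasure E) : Measure E) | μ ∈ Set.range b} := by
  have hta := isTightMeasureSet_of_isCompact_closure
    (ha.isCompact_insert_range.isClosed.closure_eq.symm ▸ ha.isCompact_insert_range)
  rw [isTightMeasureSet_iff_exists_isCompact_measure_compl_le] at hta ⊢
  intro ε hε
  obtain ⟨K₁, hK₁, h₁⟩ := hta 2⁻¹ (by simp)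
  have htγ : IsTightMeasureSet {(γ : Measure E)} := isTightMeasureSet_singleton
  rw [isTightMeasureSet_iff_exists_isCompact_measure_compl_le] at htγ
  obtain ⟨K₂, hK₂, h₂⟩ := htγ (ε / 2) (ENNReal.half_pos hε.ne')
  have hK : IsCompact (K₂ - K₁) := by
    rw [← Set.sub_image_prod]
    exact (hK₂.prod hK₁).image continuous_sub
  refine ⟨K₂ - K₁, hK, ?_⟩
  rintro _ ⟨_, ⟨n, rfl⟩, rfl⟩
  have h₃ : 2⁻¹ ≤ (a n : Measure E) K₁ := by
    have := h₁ (a n) ⟨a n, by simp, rfl⟩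
    rw [prob_compl_eq_one_sub hK₁.measurableSet] at this
    have hone : (1 : ℝ≥0∞) ≤ 2⁻¹ + (a n : Measure E) K₁ := tsub_le_iff_right.1 this
    rw [← ENNReal.inv_two_add_inv_two] at hone
    exact (ENNReal.add_le_add_iff_left (by simp)).1 hone
  have h₅ := (measure_mul_measure_compl_sub_le (h n) (K₁ := K₁) hK₂).trans (h₂ _ rfl)
  have h₆ : 2⁻¹ * (b n : Measure E) (K₂ - K₁)ᶜ ≤ 2⁻¹ * ε := by
    rw [mul_comm _ ε, ← div_eq_mul_inv]
    exact (mul_le_mul_left h₃ _).trans h₅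
  exact (ENNReal.mul_le_mul_iff_right (by simp) (by simp)).1 h₆

variable [NormedSpace ℝ E]

theorem push_conv (T : E →L[ℝ] E) (ρ σ : ProbabilityMeasure E) :
    push T (conv ρ σ) = conv (push T ρ) (push T σ) :=
  Subtype.ext (Measure.map_conv_continuousLinearMap T)

theorem convProd_succ' (T : E →L[ℝ] E) (ρ : ProbabilityMeasure E) (n : ℕ) :
    convProd T ρ (n + 1) = conv ρ (push T (convProd T ρ n)) := by
  induction n with
  | zero =>
    simp only [convProd, push_delta, map_zero, conv_delta_zero, pow_zero, push_one]
    rw [conv_comm, conv_delta_zero]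
  | succ n ih =>
    rw [convProd, ih, conv_assoc, pow_succ', ← push_push, ← push_conv,
      ← convProd, ih]

theorem convProd_conv_delta (T : E →L[ℝ] E) (ρ : ProbabilityMeasure E) (x : E) (n : ℕ) :
    convProd T (conv ρ (delta x)) n
      = conv (convProd T ρ n) (delta (∑ i ∈ Finset.range n, (T ^ i) x)) := by
  induction n with
  | zero => simp [convProd, conv_delta_zero]
  | succ n ih =>
    rw [convProd, ih, convProd, push_conv, push_delta, Finset.sum_range_succ, ← conv_delta_delta]
    ac_rfl

theorem eq_convProd_conv_push {T : E →L[ℝ] E} {μ : ProbabilityMeasure E}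
    {lam : ℤ → ProbabilityMeasure E} (h : ∀ k, lam k = conv μ (push T (lam (k - 1))))
    (k : ℤ) (n : ℕ) :
    lam k = conv (convProd T μ n) (push (T ^ n) (lam (k - n))) := by
  induction n with
  | zero =>
    simp only [convProd, pow_zero, push_one, Nat.cast_zero, sub_zero]
    rw [conv_comm, conv_delta_zero]
  | succ n ih =>
    rw [ih, h (k - n), convProd, push_conv, push_push, ← pow_succ, conv_assoc]
    simp [sub_sub]

/-- Iterating the decomposition gives ρ = `convProd T σ n` * T^n(ρ); the second factor tends to δ_0,
so the limit of the first is ρ. -/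
theorem eq_of_isStronglyDecomposable {T : E →L[ℝ] E} {σ ν ρ : ProbabilityMeasure E}
    (hν : Tendsto (convProd T σ) atTop (𝓝 ν)) (hρ : IsStronglyDecomposable T σ ρ) : ρ = ν := by
  have h (n : ℕ) : conv (convProd T σ n) (push (T ^ n) ρ) = ρ :=
    (eq_convProd_conv_push (lam := fun _ => ρ) (fun _ => hρ.1) 0 n).symm
  have h₁ := tendsto_conv hν hρ.2
  simp only [h, conv_delta_zero] at h₁
  exact tendsto_nhds_unique tendsto_const_nhds h₁

theorem eq_conv_push_of_tendsto_convProd {T : E →L[ℝ] E} {σ ν : ProbabilityMeasure E}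
    (hν : Tendsto (convProd T σ) atTop (𝓝 ν)) : ν = conv σ (push T ν) := by
  have h₁ : Tendsto (fun n => convProd T σ (n + 1)) atTop (𝓝 ν) :=
    hν.comp (tendsto_add_atTop_nat 1)
  simp only [convProd_succ'] at h₁
  exact tendsto_nhds_unique h₁ (tendsto_conv tendsto_const_nhds (tendsto_push T hν))

end Algebra

/-! ### Uniform geometric decay on the contraction subspace -/

section Contraction

variable {E : Type*} [NormedAddCommGroup E] [NormedSpace ℝ E]

theorem tendsto_pow_apply_of_mem_contractionSubspace {T : E →L[ℝ] E} {v : E}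
    (hv : v ∈ contractionSubspace T) : Tendsto (fun n : ℕ => (T ^ n) v) atTop (𝓝 0) := hv

theorem apply_mem_contractionSubspace {T : E →L[ℝ] E} {v : E}
    (hv : v ∈ contractionSubspace T) : T v ∈ contractionSubspace T := by
  have h := (tendsto_pow_apply_of_mem_contractionSubspace hv).comp (tendsto_add_atTop_nat 1)
  simpa only [Function.comp_def, pow_succ] using! h

theorem pow_apply_mem_contractionSubspace {T : E →L[ℝ] E} {v : E}
    (hv : v ∈ contractionSubspace T) (n : ℕ) : (T ^ n) v ∈ contractionSubspace T := by
  induction n with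
  | zero => simpa using hv
  | succ n ih =>
    rw [pow_succ']
    exact apply_mem_contractionSubspace ih

/-- A nonnegative sequence that halves every `m` steps decays geometrically. -/
theorem exists_geometric_bound_of_halving {a : ℕ → ℝ} {m : ℕ}
    (hm : m ≠ 0) (h : ∀ n, a (n + m) ≤ a n / 2) :
    ∃ K ρ : ℝ, 0 < K ∧ 0 < ρ ∧ ρ < 1 ∧ ∀ n, a n ≤ K * (ρ ^ 2) ^ n := by
  -- The rate is written as ρ², with ρ the 2m-th root of 1/2, so that one factor ρ^n can later
  -- absorb noise of size ρ⁻ⁿ and the other still sums.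
  set ρ : ℝ := (1 / 2) ^ ((1 : ℝ) / (2 * m)) with hρ
  have hm' : (0 : ℝ) < m := by positivity
  have hρ0 : 0 < ρ := by positivity
  have hρ1 : ρ < 1 := Real.rpow_lt_one (by norm_num) (by norm_num) (by positivity)
  have hρm : (ρ ^ 2) ^ m = 1 / 2 := by
    rw [← pow_mul, hρ, ← Real.rpow_natCast, ← Real.rpow_mul (by norm_num)]
    have : (1 : ℝ) / (2 * m) * ((2 * m : ℕ) : ℝ) = 1 := by push_cast; field_simp
    rw [this, Real.rpow_one]
  set K : ℝ := 1 + ∑ i ∈ Finset.range m, |a i| / (ρ ^ 2) ^ i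
  have hK : 0 < K := by positivity
  refine ⟨K, ρ, hK, hρ0, hρ1, fun n => ?_⟩
  induction n using Nat.strong_induction_on with
  | _ n ih =>
    rcases lt_or_ge n m with hn | hn
    · have h₁ : |a n| / (ρ ^ 2) ^ n ≤ ∑ i ∈ Finset.range m, |a i| / (ρ ^ 2) ^ i :=
        Finset.single_le_sum (f := fun i => |a i| / (ρ ^ 2) ^ i) (fun i _ => by positivity)
          (Finset.mem_range.2 hn)
      have h₂ : |a n| / (ρ ^ 2) ^ n ≤ K := by simp only [K]; linarith
      rw [div_le_iff₀ (by positivity)] at h₂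
      exact (le_abs_self _).trans h₂
    · obtain ⟨k, rfl⟩ := Nat.exists_eq_add_of_le' hn
      calc a (k + m) ≤ a k / 2 := h k
        _ ≤ K * (ρ ^ 2) ^ k / 2 := by gcongr; exact ih k (by omega)
        _ = K * (ρ ^ 2) ^ (k + m) := by rw [pow_add, hρm]; ring

theorem tendsto_opNorm_pow_zero {F : Type*} [NormedAddCommGroup F] [NormedSpace ℝ F]
    [FiniteDimensional ℝ F] {A : F →L[ℝ] F}
    (hA : ∀ v, Tendsto (fun n : ℕ => (A ^ n) v) atTop (𝓝 0)) :
    Tendsto (fun n : ℕ => ‖A ^ n‖) atTop (𝓝 0) := by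
  set b := Module.finBasis ℝ F
  obtain ⟨C, -, hC⟩ := b.exists_opNorm_le (F := F)
  have h₁ : Tendsto (fun n : ℕ => C * ∑ i, ‖(A ^ n) (b i)‖) atTop (𝓝 0) := by
    have := (tendsto_finsetSum Finset.univ fun i _ => (hA (b i)).norm).const_mul C
    simpa using this
  refine squeeze_zero (fun _ => norm_nonneg _) (fun n => hC (by positivity) fun i => ?_) h₁
  exact Finset.single_le_sum (f := fun i => ‖(A ^ n) (b i)‖) (fun i _ => norm_nonneg _)
    (Finset.mem_univ i)

/-- In finite dimension pointwise convergence to 0 on C(T) is convergence in operator norm, so some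
power of the restriction has norm at most 1/2, and submultiplicativity gives halving. -/
theorem exists_geometric_bound_contractionSubspace [FiniteDimensional ℝ E] (T : E →L[ℝ] E) :
    ∃ K ρ : ℝ, 0 < K ∧ 0 < ρ ∧ ρ < 1 ∧
      ∀ v ∈ contractionSubspace T, ∀ n : ℕ, ‖(T ^ n) v‖ ≤ K * (ρ ^ 2) ^ n * ‖v‖ := by
  set A : contractionSubspace T →L[ℝ] contractionSubspace T :=
    T.restrict (fun v hv => apply_mem_contractionSubspace hv) with hAdef
  have hpow (n : ℕ) (v : contractionSubspace T) : (((A ^ n) v : contractionSubspace T) : E)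
      = (T ^ n) v := by
    induction n with
    | zero => simp
    | succ n ih =>
      rw [pow_succ', pow_succ']
      change T ((A ^ n) v : contractionSubspace T) = T ((T ^ n) v)
      rw [ih]
  have hlim : Tendsto (fun n : ℕ => ‖A ^ n‖) atTop (𝓝 0) := by
    refine tendsto_opNorm_pow_zero fun v => ?_
    rw [tendsto_subtype_rng]
    simpa only [hpow] using! tendsto_pow_apply_of_mem_contractionSubspace v.2
  obtain ⟨m, hm, hm0⟩ := ((hlim.eventually_le_const (by norm_num : (0 : ℝ) < 1 / 2)).and
    (eventually_ne_atTop 0)).exists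
  obtain ⟨K, ρ, hK, hρ0, hρ1, h⟩ := exists_geometric_bound_of_halving (a := fun n => ‖A ^ n‖) hm0
    fun n => by
      rw [pow_add, div_eq_mul_one_div]
      exact ((A ^ n).opNorm_comp_le (A ^ m)).trans
        (mul_le_mul_of_nonneg_left hm (norm_nonneg (A ^ n)))
  refine ⟨K, ρ, hK, hρ0, hρ1, fun v hv n => ?_⟩
  have := ((A ^ n).le_opNorm ⟨v, hv⟩).trans (mul_le_mul_of_nonneg_right (h n) (norm_nonneg _))
  rwa [← Submodule.norm_coe, hpow] at this

end Contraction

/-! ### Almost sure convergence of the random series -/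

section Series

theorem tendsto_map_of_ae_tendsto {Ω F : Type*} [MeasurableSpace Ω] [TopologicalSpace F]
    [MeasurableSpace F] [OpensMeasurableSpace F]
    {P : ProbabilityMeasure Ω} {X : ℕ → Ω → F} {Z : Ω → F}
    (hX : ∀ n, AEMeasurable (X n) P) (hZ : AEMeasurable Z P)
    (h : ∀ᵐ ω ∂(P : Measure Ω), Tendsto (fun n => X n ω) atTop (𝓝 (Z ω))) :
    Tendsto (fun n => P.map (hX n)) atTop (𝓝 (P.map hZ)) := by
  rw [ProbabilityMeasure.tendsto_iff_forall_integral_tendsto]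
  intro f
  have hmap {Y : Ω → F} (hY : AEMeasurable Y P) :
      ∫ x, f x ∂((P.map hY : ProbabilityMeasure F) : Measure F) = ∫ ω, f (Y ω) ∂(P : Measure Ω) :=
    integral_map hY f.continuous.measurable.aestronglyMeasurable
  simp only [hmap]
  refine tendsto_integral_of_dominated_convergence (fun _ => ‖f‖)
    (fun n => (f.continuous.measurable.comp_aemeasurable (hX n)).aestronglyMeasurable)
    (integrable_const _) (fun n => ae_of_all _ fun ω => f.norm_coe_le_norm _) ?_
  filter_upwards [h] with ω hω
  exact (f.continuous.tendsto _).comp hω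

theorem tsum_indicator_natCast_mul_lt_le {c x : ℝ} (hc : 0 < c) (hx : 0 ≤ x) :
    ∑' i : ℕ, ({i : ℕ | i * c < x}.indicator 1 i : ℝ≥0∞) ≤ ENNReal.ofReal (x / c) + 1 := by
  have hsub : ∀ i ∉ Finset.range ⌈x / c⌉₊,
      ({i : ℕ | i * c < x}.indicator 1 i : ℝ≥0∞) = 0 := by
    intro i hi
    refine Set.indicator_of_notMem ?_ _
    rw [Finset.mem_range, not_lt, Nat.ceil_le, div_le_iff₀ hc] at hi
    simpa using hi
  rw [tsum_eq_sum hsub]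
  calc ∑ i ∈ Finset.range ⌈x / c⌉₊, ({i : ℕ | i * c < x}.indicator 1 i : ℝ≥0∞)
      ≤ ∑ i ∈ Finset.range ⌈x / c⌉₊, 1 :=
        Finset.sum_le_sum fun i _ => Set.indicator_le_self' (fun _ _ => zero_le) i
    _ = ENNReal.ofReal (⌈x / c⌉₊ : ℝ) := by simp
    _ ≤ ENNReal.ofReal (x / c + 1) :=
        ENNReal.ofReal_le_ofReal (Nat.ceil_lt_add_one (by positivity)).le
    _ ≤ _ := by
        rw [ENNReal.ofReal_add (by positivity) zero_le_one, ENNReal.ofReal_one]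

/-- By Tonelli the sum is the expected number of i with i * c < log(‖v‖ + 1), a number that is at
most log(‖v‖ + 1) / c + 1. -/
theorem tsum_measure_log_gt_ne_top {E : Type*} [NormedAddCommGroup E] [MeasurableSpace E]
    [BorelSpace E] {σ : Measure E} [IsProbabilityMeasure σ]
    (hσ : ∫⁻ v, ENNReal.ofReal (Real.log (‖v‖ + 1)) ∂σ < ∞) {c : ℝ} (hc : 0 < c) :
    ∑' i : ℕ, σ {v | i * c < Real.log (‖v‖ + 1)} ≠ ∞ := by
  have hmeas (i : ℕ) : MeasurableSet {v : E | i * c < Real.log (‖v‖ + 1)} :=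
    measurableSet_lt measurable_const (by fun_prop)
  have hlog (v : E) : 0 ≤ Real.log (‖v‖ + 1) := Real.log_nonneg (by linarith [norm_nonneg v])
  simp only [← fun i => lintegral_indicator_one (μ := σ) (hmeas i)]
  rw [← lintegral_tsum fun i => (measurable_one.indicator (hmeas i)).aemeasurable]
  refine ne_top_of_le_ne_top ?_ (lintegral_mono (g := fun v =>
    ENNReal.ofReal (Real.log (‖v‖ + 1)) * ENNReal.ofReal c⁻¹ + 1) fun v => ?_)
  · rw [lintegral_add_right _ measurable_const, lintegral_mul_const _ (by fun_prop)]
    simpa using ENNReal.mul_ne_top hσ.ne ENNReal.ofReal_ne_top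
  · refine le_trans ?_ ((tsum_indicator_natCast_mul_lt_le hc (hlog v)).trans ?_)
    · exact le_of_eq rfl
    · rw [div_eq_mul_inv, ENNReal.ofReal_mul (hlog v)]

/-- The law of an i.i.d. sequence with common law `σ`. -/
noncomputable def iidLaw {E : Type*} [MeasurableSpace E] (σ : ProbabilityMeasure E) :
    ProbabilityMeasure (ℕ → E) :=
  ⟨Measure.infinitePi fun _ => (σ : Measure E), inferInstance⟩

theorem iidLaw_map_eval {E : Type*} [MeasurableSpace E] (σ : ProbabilityMeasure E) (i : ℕ) :
    Measure.map (fun ω : ℕ → E => ω i) (iidLaw σ : Measure (ℕ → E)) = σ :=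
  Measure.infinitePi_map_eval _ i

variable {E : Type*} [NormedAddCommGroup E] [NormedSpace ℝ E] [MeasurableSpace E] [BorelSpace E]

/-- By Borel–Cantelli, almost surely ‖ω i‖ ≤ ρ⁻ⁱ for all large i; against the decay ρ²ⁱ this leaves
the convergent series ∑ K ρⁱ. -/
theorem ae_summable_pow_apply [FiniteDimensional ℝ E] {T : E →L[ℝ] E} {σ : ProbabilityMeasure E}
    (hC : ∀ᵐ v ∂(σ : Measure E), v ∈ contractionSubspace T)
    (hlog : ∫⁻ v, ENNReal.ofReal (Real.log (‖v‖ + 1)) ∂(σ : Measure E) < ∞) :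
    ∀ᵐ ω ∂(iidLaw σ : Measure (ℕ → E)),
      (∀ i, ω i ∈ contractionSubspace T) ∧ Summable fun i => (T ^ i) (ω i) := by
  obtain ⟨K, ρ, hK, hρ0, hρ1, hdecay⟩ := exists_geometric_bound_contractionSubspace T
  have hc : 0 < -Real.log ρ := neg_pos.2 (Real.log_neg hρ0 hρ1)
  have hmem : ∀ᵐ ω ∂(iidLaw σ : Measure (ℕ → E)), ∀ i, ω i ∈ contractionSubspace T :=
    ae_all_iff.2 fun i => by
      rw [← iidLaw_map_eval σ i] at hC
      exact ae_of_ae_map (measurable_pi_apply i).aemeasurable hC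
  have hBC : ∀ᵐ ω ∂(iidLaw σ : Measure (ℕ → E)), ∀ᶠ i : ℕ in atTop,
      ω ∉ {ω : ℕ → E | i * -Real.log ρ < Real.log (‖ω i‖ + 1)} := by
    refine ae_eventually_notMem ?_
    refine ne_of_eq_of_ne (tsum_congr fun i => ?_) (tsum_measure_log_gt_ne_top hlog hc)
    rw [← congrArg (· {v : E | i * -Real.log ρ < Real.log (‖v‖ + 1)}) (iidLaw_map_eval σ i)]
    rw [Measure.map_apply (measurable_pi_apply i)
      (measurableSet_lt measurable_const (by fun_prop))]
    rfl
  filter_upwards [hmem, hBC] with ω h₁ h₂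
  refine ⟨h₁, ?_⟩
  refine Summable.of_norm_bounded_eventually_nat
    ((summable_geometric_of_lt_one hρ0.le hρ1).mul_left K) ?_
  filter_upwards [h₂] with i hi
  have h₃ : Real.log (‖ω i‖ + 1) ≤ Real.log (ρ⁻¹ ^ i) := by
    rw [Real.log_pow, Real.log_inv]
    simpa using hi
  have h₄ : ‖ω i‖ ≤ ρ⁻¹ ^ i := by
    have := (Real.log_le_log_iff (by positivity) (by positivity)).1 h₃
    linarith
  calc ‖(T ^ i) (ω i)‖ ≤ K * (ρ ^ 2) ^ i * ‖ω i‖ := hdecay _ (h₁ i) i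
    _ ≤ K * (ρ ^ 2) ^ i * ρ⁻¹ ^ i := by gcongr
    _ = K * ρ ^ i := by
      rw [mul_assoc, ← mul_pow]
      congr 2
      field_simp

variable [SecondCountableTopology E]

theorem measurable_sum_pow_apply (T : E →L[ℝ] E) (n : ℕ) :
    Measurable fun ω : ℕ → E => ∑ i ∈ Finset.range n, (T ^ i) (ω i) :=
  Finset.measurable_sum _ fun i _ => (T ^ i).measurable.comp (measurable_pi_apply i)

/-- Independence of the coordinates realises the convolution product as the law of a partial sum, so
almost sure convergence yields weak convergence. -/
theorem convProd_eq_map (T : E →L[ℝ] E) (σ : ProbabilityMeasure E) (n : ℕ) :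
    convProd T σ n = (iidLaw σ).map (measurable_sum_pow_apply T n).aemeasurable := by
  induction n with
  | zero =>
    refine Subtype.ext ?_
    change Measure.dirac 0 = Measure.map _ _
    simp
  | succ n ih =>
    rw [convProd, ih]
    refine Subtype.ext ?_
    have hmeas (i : ℕ) : Measurable fun ω : ℕ → E => (T ^ i) (ω i) :=
      (T ^ i).measurable.comp (measurable_pi_apply i)
    have hindep := (ProbabilityTheory.iIndepFun_infinitePi (P := fun _ : ℕ => (σ : Measure E))
      (X := fun i v => (T ^ i) v) fun i => (T ^ i).measurable).indepFun_sum_range_succ hmeas n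
    have hsum : (∑ j ∈ Finset.range n, fun ω : ℕ → E => (T ^ j) (ω j))
        = fun ω => ∑ j ∈ Finset.range n, (T ^ j) (ω j) := by
      ext ω; simp
    rw [hsum] at hindep
    have h := hindep.map_add_eq_map_conv_map (measurable_sum_pow_apply T n) (hmeas n)
    have hlast : Measure.map (fun ω : ℕ → E => (T ^ n) (ω n)) (iidLaw σ : Measure (ℕ → E))
        = Measure.map (T ^ n) (σ : Measure E) := by
      rw [← iidLaw_map_eval σ n, Measure.map_map (T ^ n).measurable (measurable_pi_apply n)]
      rfl
    change Measure.conv (Measure.map _ (iidLaw σ : Measure (ℕ → E))) (Measure.map (T ^ n) _)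
      = Measure.map _ _
    rw [← hlast]
    refine h.symm.trans ?_
    congr 1
    ext ω
    simp [Finset.sum_range_succ]

/-- If `σ` lives on the contraction subspace and has a logarithmic moment, then the convolution
products `∏ T^{i-1}(σ)` converge to a strongly `T`-decomposable measure. -/
theorem exists_tendsto_convProd [FiniteDimensional ℝ E] {T : E →L[ℝ] E} {σ : ProbabilityMeasure E}
    (hC : ∀ᵐ v ∂(σ : Measure E), v ∈ contractionSubspace T)
    (hlog : ∫⁻ v, ENNReal.ofReal (Real.log (‖v‖ + 1)) ∂(σ : Measure E) < ∞) :
    ∃ ν : ProbabilityMeasure E, Tendsto (convProd T σ) atTop (𝓝 ν) ∧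
      IsStronglyDecomposable T σ ν := by
  have hae := ae_summable_pow_apply hC hlog
  set Z : (ℕ → E) → E := fun ω => ∑' i, (T ^ i) (ω i)
  have hlim : ∀ᵐ ω ∂(iidLaw σ : Measure (ℕ → E)),
      Tendsto (fun n => ∑ i ∈ Finset.range n, (T ^ i) (ω i)) atTop (𝓝 (Z ω)) := by
    filter_upwards [hae] with ω hω
    exact hω.2.hasSum.tendsto_sum_nat
  have hZ : AEMeasurable Z (iidLaw σ : Measure (ℕ → E)) :=
    aemeasurable_of_tendsto_metrizable_ae atTop
      (fun n => (measurable_sum_pow_apply T n).aemeasurable) hlim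
  -- C(T) is closed, so the sum of the series stays in it; this is what makes T^n(ν) → δ_0.
  have hZC : ∀ᵐ ω ∂(iidLaw σ : Measure (ℕ → E)), Z ω ∈ contractionSubspace T := by
    filter_upwards [hae, hlim] with ω h₁ h₂
    exact (contractionSubspace T).closed_of_finiteDimensional.mem_of_tendsto h₂
      (Eventually.of_forall fun n => Submodule.sum_mem _ fun i _ =>
        pow_apply_mem_contractionSubspace (h₁.1 i) i)
  have hν : Tendsto (convProd T σ) atTop (𝓝 ((iidLaw σ).map hZ)) := by
    rw [funext (convProd_eq_map T σ)]
    exact tendsto_map_of_ae_tendsto _ hZ hlim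
  refine ⟨(iidLaw σ).map hZ, hν, eq_conv_push_of_tendsto_convProd hν, ?_⟩
  have hTZ (n : ℕ) : AEMeasurable (fun ω => (T ^ n) (Z ω)) (iidLaw σ : Measure (ℕ → E)) :=
    (T ^ n).measurable.comp_aemeasurable hZ
  have h0 : AEMeasurable (fun _ => (0 : E)) (iidLaw σ : Measure (ℕ → E)) := aemeasurable_const
  have h₁ := tendsto_map_of_ae_tendsto hTZ h0 (by
    filter_upwards [hZC] with ω hω
    exact tendsto_pow_apply_of_mem_contractionSubspace hω)
  have h₂ (n : ℕ) : push (T ^ n) ((iidLaw σ).map hZ) = (iidLaw σ).map (hTZ n) :=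
    Subtype.ext (AEMeasurable.map_map_of_aemeasurable (T ^ n).measurable.aemeasurable hZ)
  have h₃ : (iidLaw σ).map h0 = delta 0 := by
    refine Subtype.ext ?_
    change Measure.map _ _ = Measure.dirac 0
    simp
  simpa only [h₂, h₃] using h₁

end Series

/-! ### Characteristic functions and symmetrization -/

section CharFun

variable {E : Type*} [NormedAddCommGroup E] [NormedSpace ℝ E] [MeasurableSpace E] [BorelSpace E]

theorem integrable_cos_apply (ν : ProbabilityMeasure E) (L : StrongDual ℝ E) :
    Integrable (fun x => Real.cos (L x)) (ν : Measure E) :=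
  Integrable.of_bound (Real.measurable_cos.comp L.measurable).aestronglyMeasurable 1
    (ae_of_all _ fun _ => Real.abs_cos_le_one _)

theorem re_charFunDual (ν : ProbabilityMeasure E) (L : StrongDual ℝ E) :
    (charFunDual (ν : Measure E) L).re = ∫ x, Real.cos (L x) ∂(ν : Measure E) := by
  have hint : Integrable (fun x => Complex.exp (L x * Complex.I)) (ν : Measure E) :=
    Integrable.of_bound (by fun_prop) 1
      (ae_of_all _ fun _ => (Complex.norm_exp_ofReal_mul_I _).le)
  rw [charFunDual_apply]
  have := integral_re hint
  simp only [RCLike.re_eq_complex_re, Complex.exp_ofReal_mul_I_re] at this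
  exact this.symm

/-- Integrate 1 - cos 2θ = 2(1 - cos θ)(1 + cos θ) ≤ 4(1 - cos θ). -/
theorem one_sub_re_charFunDual_two_smul_le (ν : ProbabilityMeasure E) (L : StrongDual ℝ E) :
    1 - (charFunDual (ν : Measure E) ((2 : ℝ) • L)).re
      ≤ 4 * (1 - (charFunDual (ν : Measure E) L).re) := by
  have h (M : StrongDual ℝ E) : 1 - (charFunDual (ν : Measure E) M).re
      = ∫ x, (1 - Real.cos (M x)) ∂(ν : Measure E) := by
    rw [integral_sub (integrable_const _) (integrable_cos_apply ν M), re_charFunDual]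
    simp
  rw [h, h, ← integral_const_mul]
  refine integral_mono ((integrable_const _).sub (integrable_cos_apply ν _))
    (((integrable_const _).sub (integrable_cos_apply ν L)).const_mul 4) fun x => ?_
  simp only [_root_.smul_apply, smul_eq_mul, Real.cos_two_mul]
  nlinarith [Real.cos_le_one (L x), Real.neg_one_le_cos (L x), sq_nonneg (1 - Real.cos (L x))]

theorem one_sub_re_charFunDual_two_pow_smul_le (ν : ProbabilityMeasure E) (L : StrongDual ℝ E)
    (k : ℕ) : 1 - (charFunDual (ν : Measure E) ((2 : ℝ) ^ k • L)).re
      ≤ 4 ^ k * (1 - (charFunDual (ν : Measure E) L).re) := by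
  induction k with
  | zero => simp
  | succ k ih =>
    rw [pow_succ', mul_smul, pow_succ', mul_assoc]
    exact (one_sub_re_charFunDual_two_smul_le ν _).trans (by gcongr)

theorem charFunDual_push (T : E →L[ℝ] E) (ρ : ProbabilityMeasure E) (L : StrongDual ℝ E) :
    charFunDual (push T ρ : Measure E) L = charFunDual (ρ : Measure E) (L.comp T) :=
  charFunDual_map T L

theorem norm_sq_charFunDual_le_one (ρ : ProbabilityMeasure E) (L : StrongDual ℝ E) :
    ‖charFunDual (ρ : Measure E) L‖ ^ 2 ≤ 1 := by
  have : IsProbabilityMeasure ((ρ : Measure E).map L) :=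
    Measure.isProbabilityMeasure_map L.measurable.aemeasurable
  rw [charFunDual_eq_charFun_map_one]
  exact pow_le_one₀ (norm_nonneg _) (norm_charFun_le_one 1)

/-- Since a ≤ exp(-(1 - a)), a sum exceeding 1 would push the product below exp(-1) < 1/2. -/
theorem sum_one_sub_le_one_of_half_le_prod {a : ℕ → ℝ} {n : ℕ} (h₀ : ∀ i, 0 ≤ a i)
    (h : 1 / 2 ≤ ∏ i ∈ Finset.range n, a i) : ∑ i ∈ Finset.range n, (1 - a i) ≤ 1 := by
  have h₁ : ∏ i ∈ Finset.range n, a i ≤ Real.exp (-∑ i ∈ Finset.range n, (1 - a i)) := by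
    rw [← Finset.sum_neg_distrib, Real.exp_sum]
    refine Finset.prod_le_prod (fun i _ => h₀ i) fun i _ => ?_
    have := Real.add_one_le_exp (-(1 - a i))
    linarith
  by_contra hcon
  have h₂ : Real.exp (-∑ i ∈ Finset.range n, (1 - a i)) < Real.exp (-1) :=
    Real.exp_lt_exp.2 (by linarith)
  have h₃ : Real.exp (-1) < 1 / 2 := by
    rw [Real.exp_neg, one_div]
    exact inv_strictAnti₀ (by norm_num) (by linarith [Real.exp_one_gt_d9])
  linarith

variable [SecondCountableTopology E]

/-- The symmetrization `ρ * (-ρ)` of a probability measure. -/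
noncomputable def symmetrization (ρ : ProbabilityMeasure E) : ProbabilityMeasure E :=
  conv ρ (push (-1) ρ)

theorem charFunDual_conv_eq_mul (ρ σ : ProbabilityMeasure E) (L : StrongDual ℝ E) :
    charFunDual (conv ρ σ : Measure E) L
      = charFunDual (ρ : Measure E) L * charFunDual (σ : Measure E) L :=
  charFunDual_conv L

theorem charFunDual_symmetrization (ρ : ProbabilityMeasure E) (L : StrongDual ℝ E) :
    charFunDual (symmetrization ρ : Measure E) L
      = ((‖charFunDual (ρ : Measure E) L‖ ^ 2 : ℝ) : ℂ) := by
  rw [symmetrization, charFunDual_conv_eq_mul, charFunDual_push, Complex.ofReal_pow,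
    ← Complex.mul_conj']
  congr 1
  rw [charFunDual_apply, charFunDual_apply, ← integral_conj]
  congr 1 with x
  rw [← Complex.exp_conj]
  simp

theorem charFunDual_convProd (T : E →L[ℝ] E) (ρ : ProbabilityMeasure E) (L : StrongDual ℝ E)
    (n : ℕ) : charFunDual (convProd T ρ n : Measure E) L
      = ∏ i ∈ Finset.range n, charFunDual (ρ : Measure E) (L.comp (T ^ i)) := by
  induction n with
  | zero =>
    change charFunDual (Measure.dirac 0) L = _
    simp
  | succ n ih => rw [convProd, charFunDual_conv_eq_mul, charFunDual_push, ih, Finset.prod_range_succ]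

/-- If `conv (convProd T μ n) (β n) = γ` for all `n`, then the characteristic functions of the
factors `T^i(μ)` satisfy a summability bound near the origin, on every ray. -/
theorem exists_sum_one_sub_norm_sq_charFunDual_le_one {T : E →L[ℝ] E}
    {μ γ : ProbabilityMeasure E} {β : ℕ → ProbabilityMeasure E}
    (h : ∀ n, conv (convProd T μ n) (β n) = γ) (L : StrongDual ℝ E) :
    ∃ δ > 0, ∀ t : ℝ, |t| ≤ δ → ∀ n, ∑ i ∈ Finset.range n,
      (1 - ‖charFunDual (μ : Measure E) ((t • L).comp (T ^ i))‖ ^ 2) ≤ 1 := by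
  have hcont : Continuous fun t : ℝ => ‖charFunDual (γ : Measure E) (t • L)‖ ^ 2 := by
    simp only [← charFun_map_eq_charFunDual_smul]
    exact (continuous_charFun.norm).pow 2
  have h0 : (1 : ℝ) / 2 < ‖charFunDual (γ : Measure E) ((0 : ℝ) • L)‖ ^ 2 := by
    norm_num [charFunDual_apply]
  obtain ⟨δ, hδ, hball⟩ := Metric.eventually_nhds_iff.1
    (hcont.continuousAt.eventually (lt_mem_nhds h0))
  refine ⟨δ / 2, half_pos hδ, fun t ht n => ?_⟩
  refine sum_one_sub_le_one_of_half_le_prod (fun _ => by positivity) ?_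
  have h₁ : 1 / 2 < ‖charFunDual (γ : Measure E) (t • L)‖ ^ 2 := by
    refine hball ?_
    rw [Real.dist_eq, sub_zero]
    linarith
  rw [← h n, charFunDual_conv_eq_mul, charFunDual_convProd, norm_mul, mul_pow, norm_prod,
    ← Finset.prod_pow] at h₁
  refine h₁.le.trans (mul_le_of_le_one_right (by positivity) (norm_sq_charFunDual_le_one _ _))

/-- The squared modulus is the characteristic function of the symmetrization, so the doubling
inequality applies to it: k doublings carry the bound from |t| ≤ δ to |t| ≤ R at the cost of 4^k. -/
theorem exists_sum_one_sub_norm_sq_charFunDual_le {T : E →L[ℝ] E}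
    {μ γ : ProbabilityMeasure E} {β : ℕ → ProbabilityMeasure E}
    (h : ∀ n, conv (convProd T μ n) (β n) = γ) (L : StrongDual ℝ E) (R : ℝ) :
    ∃ C : ℝ, ∀ t : ℝ, |t| ≤ R → ∀ n, ∑ i ∈ Finset.range n,
      (1 - ‖charFunDual (μ : Measure E) ((t • L).comp (T ^ i))‖ ^ 2) ≤ C := by
  obtain ⟨δ, hδ, hδ'⟩ := exists_sum_one_sub_norm_sq_charFunDual_le_one h L
  obtain ⟨k, hk⟩ := pow_unbounded_of_one_lt (R / δ) (one_lt_two : (1 : ℝ) < 2)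
  rw [div_lt_iff₀ hδ] at hk
  refine ⟨4 ^ k, fun t ht n => ?_⟩
  have hsym (M : StrongDual ℝ E) : ‖charFunDual (μ : Measure E) M‖ ^ 2
      = (charFunDual (symmetrization μ : Measure E) M).re := by
    rw [charFunDual_symmetrization, Complex.ofReal_re]
  set s : ℝ := t / 2 ^ k with hs
  have hts : t = 2 ^ k * s := by rw [hs]; field_simp
  have hsδ : |s| ≤ δ := by
    rw [hs, abs_div, abs_of_pos (by positivity : (0 : ℝ) < 2 ^ k), div_le_iff₀ (by positivity)]
    linarith
  calc ∑ i ∈ Finset.range n, (1 - ‖charFunDual (μ : Measure E) ((t • L).comp (T ^ i))‖ ^ 2)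
      ≤ ∑ i ∈ Finset.range n,
        4 ^ k * (1 - ‖charFunDual (μ : Measure E) ((s • L).comp (T ^ i))‖ ^ 2) := by
        refine Finset.sum_le_sum fun i _ => ?_
        rw [hsym, hsym, hts, mul_smul, ContinuousLinearMap.smul_comp]
        exact one_sub_re_charFunDual_two_pow_smul_le _ _ k
    _ ≤ 4 ^ k := by
        rw [← Finset.mul_sum]
        exact mul_le_of_le_one_right (by positivity) (hδ' s hsδ n)

theorem exists_sum_symmetrization_dual_gt_le {T : E →L[ℝ] E}
    {μ γ : ProbabilityMeasure E} {β : ℕ → ProbabilityMeasure E}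
    (h : ∀ n, conv (convProd T μ n) (β n) = γ) (L : StrongDual ℝ E) {r : ℝ} (hr : 0 < r) :
    ∃ C : ℝ, ∀ n, ∑ i ∈ Finset.range n,
      (symmetrization μ : Measure E).real {x | r < |L ((T ^ i) x)|} ≤ C := by
  obtain ⟨C, hC⟩ := exists_sum_one_sub_norm_sq_charFunDual_le h L (2 * r⁻¹)
  refine ⟨2 * C, fun n => ?_⟩
  set f : ℕ → ℝ → ℝ := fun i t =>
    1 - ‖charFunDual (μ : Measure E) ((t • L).comp (T ^ i))‖ ^ 2 with hf
  have hfcont (i : ℕ) : Continuous (f i) := by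
    have : Continuous fun t : ℝ => charFunDual (μ : Measure E) (t • L.comp (T ^ i)) := by
      simp only [← charFun_map_eq_charFunDual_smul]
      exact continuous_charFun
    exact continuous_const.sub (this.norm.pow 2)
  have hle : -2 * r⁻¹ ≤ 2 * r⁻¹ := by
    have : 0 < r⁻¹ := inv_pos.2 hr
    linarith
  have hbound (i : ℕ) : (symmetrization μ : Measure E).real {x | r < |L ((T ^ i) x)|}
      ≤ 2⁻¹ * r * ∫ t in (-2 * r⁻¹)..(2 * r⁻¹), f i t := by
    -- Truncation inequality: the tail beyond r is controlled by the average of 1 minus the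
    -- characteristic function over |t| ≤ 2/r.
    refine (measureReal_abs_dual_gt_le_integral_charFunDual (L.comp (T ^ i)) hr).trans_eq ?_
    congr 1
    have : (fun t : ℝ => 1 - charFunDual (symmetrization μ : Measure E) (t • L.comp (T ^ i)))
        = fun t => ((f i t : ℝ) : ℂ) := by
      ext t
      rw [charFunDual_symmetrization, hf]
      simp [ContinuousLinearMap.smul_comp]
    rw [this, intervalIntegral.integral_ofReal, Complex.norm_real, Real.norm_of_nonneg]
    exact intervalIntegral.integral_nonneg hle fun t _ =>
      sub_nonneg.2 (norm_sq_charFunDual_le_one _ _)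
  calc ∑ i ∈ Finset.range n, (symmetrization μ : Measure E).real {x | r < |L ((T ^ i) x)|}
      ≤ ∑ i ∈ Finset.range n, 2⁻¹ * r * ∫ t in (-2 * r⁻¹)..(2 * r⁻¹), f i t :=
        Finset.sum_le_sum fun i _ => hbound i
    _ = 2⁻¹ * r * ∫ t in (-2 * r⁻¹)..(2 * r⁻¹), ∑ i ∈ Finset.range n, f i t := by
        rw [← Finset.mul_sum, intervalIntegral.integral_finsetSum fun i _ =>
          (hfcont i).intervalIntegrable _ _]
    _ ≤ 2⁻¹ * r * ∫ t in (-2 * r⁻¹)..(2 * r⁻¹), C := by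
        gcongr
        refine intervalIntegral.integral_mono_on hle
          (Continuous.intervalIntegrable (by fun_prop) _ _) (by simp) fun t ht => ?_
        exact hC t (abs_le.2 ⟨by linarith [ht.1], ht.2⟩) n
    _ = 2 * C := by
        rw [intervalIntegral.integral_const, smul_eq_mul]
        field_simp
        ring

theorem symmetrization_apply (μ : ProbabilityMeasure E) {s : Set E} (hs : MeasurableSet s) :
    (symmetrization μ : Measure E) s
      = ∫⁻ y, (μ : Measure E) {x | x - y ∈ s} ∂(μ : Measure E) := by
  have h : (symmetrization μ : Measure E)
      = Measure.map (fun p : E × E => p.1 - p.2) ((μ : Measure E).prod μ) := by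
    change Measure.map (fun p : E × E => p.1 + p.2)
      ((μ : Measure E).prod (Measure.map (-1 : E →L[ℝ] E) μ)) = _
    conv_lhs => rw [← Measure.map_id (μ := (μ : Measure E))]
    rw [Measure.map_prod_map _ _ measurable_id (-1 : E →L[ℝ] E).measurable,
      Measure.map_map (by fun_prop) (by fun_prop)]
    simp only [Measure.map_id]
    congr 1
    ext p
    simp [sub_eq_add_neg]
  rw [h, Measure.map_apply (by fun_prop) hs, Measure.prod_apply_symm
    (measurable_sub hs)]
  rfl

end CharFun

/-! ### Norm estimates, affine orbits and a Borel–Cantelli criterion -/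

section Linear

variable {E : Type*} [NormedAddCommGroup E] [NormedSpace ℝ E]

theorem exists_dual_family_norm_gt [FiniteDimensional ℝ E] (r : ℝ) (hr : 0 < r) :
    ∃ (s : ℝ) (L : Fin (Module.finrank ℝ E) → StrongDual ℝ E), 0 < s ∧
      ∀ v, r < ‖v‖ → ∃ j, s < |L j v| := by
  set b := Module.finBasis ℝ E
  set B : ℝ := 1 + ∑ j, ‖b j‖ with hB
  have hB0 : 0 < B := by positivity
  refine ⟨r / B, fun j => (b.coord j).toContinuousLinearMap, by positivity, fun v hv => ?_⟩
  by_contra! hcon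
  refine hv.not_ge ?_
  calc ‖v‖ = ‖∑ j, b.repr v j • b j‖ := by rw [b.sum_repr]
    _ ≤ ∑ j, ‖b.repr v j • b j‖ := norm_sum_le _ _
    _ ≤ ∑ j, r / B * ‖b j‖ := by
        refine Finset.sum_le_sum fun j _ => ?_
        rw [norm_smul]
        exact mul_le_mul_of_nonneg_right (hcon j) (norm_nonneg _)
    _ ≤ r / B * B := by
        rw [← Finset.mul_sum]
        gcongr
        rw [hB]
        linarith
    _ = r := by field_simp

/-- One application of φ shrinks a norm by at most a factor M, so a vector with ‖v‖ > 1 keeps norm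
above 1 for at least log ‖v‖ / log M iterates, and the sum counts these. -/
theorem ofReal_log_norm_le_tsum (φ : E ≃L[ℝ] E) :
    ∃ c : ℝ≥0∞, c ≠ ∞ ∧ ∀ v : E, ENNReal.ofReal (Real.log (‖v‖ + 1)) ≤ ENNReal.ofReal (Real.log 2)
      + c * ∑' i : ℕ, ({v | 1 < ‖((φ : E →L[ℝ] E) ^ i) v‖} : Set E).indicator 1 v := by
  -- Adding 2 ensures log M > 0, even when φ⁻¹ is itself a contraction.
  set M : ℝ := ‖(φ.symm : E →L[ℝ] E)‖ + 2
  have hM : 1 < M := by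
    have := norm_nonneg (φ.symm : E →L[ℝ] E)
    simp only [M]; linarith
  have hlogM : 0 < Real.log M := Real.log_pos hM
  have hstep (v : E) : ‖v‖ ≤ M * ‖φ v‖ := by
    have h := (φ.symm : E →L[ℝ] E).le_opNorm (φ v)
    rw [ContinuousLinearEquiv.coe_coe, φ.symm_apply_apply] at h
    refine h.trans (mul_le_mul_of_nonneg_right ?_ (norm_nonneg _))
    simp [M]
  have hpow (i : ℕ) (v : E) : ‖v‖ ≤ M ^ i * ‖((φ : E →L[ℝ] E) ^ i) v‖ := by
    induction i with
    | zero => simp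
    | succ i ih =>
      refine ih.trans ?_
      rw [pow_succ M, mul_assoc, pow_succ' (φ : E →L[ℝ] E)]
      gcongr
      exact hstep _
  refine ⟨ENNReal.ofReal (Real.log M), ENNReal.ofReal_ne_top, fun v => ?_⟩
  rcases le_or_gt ‖v‖ 1 with hv | hv
  · refine le_add_right (ENNReal.ofReal_le_ofReal (Real.log_le_log (by positivity) (by linarith)))
  have hv0 : 0 < ‖v‖ := by linarith
  set n := ⌈Real.log ‖v‖ / Real.log M⌉₊
  have hcount : (n : ℝ≥0∞)
      ≤ ∑' i : ℕ, ({v | 1 < ‖((φ : E →L[ℝ] E) ^ i) v‖} : Set E).indicator 1 v := by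
    calc (n : ℝ≥0∞) = ∑ i ∈ Finset.range n,
          ({v | 1 < ‖((φ : E →L[ℝ] E) ^ i) v‖} : Set E).indicator 1 v := by
          rw [Finset.sum_congr rfl (g := fun _ => 1)]
          · simp
          · intro i hi
            refine Set.indicator_of_mem ?_ _
            rw [Finset.mem_range, Nat.lt_ceil, lt_div_iff₀ hlogM, ← Real.log_pow,
              Real.log_lt_log_iff (by positivity) hv0] at hi
            have hlt := hi.trans_le (hpow i v)
            exact (lt_mul_iff_one_lt_right (by positivity)).1 hlt
      _ ≤ _ := ENNReal.sum_le_tsum _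
  have hlog : Real.log (‖v‖ + 1) ≤ Real.log 2 + Real.log ‖v‖ := by
    rw [← Real.log_mul (by norm_num) hv0.ne']
    exact Real.log_le_log (by positivity) (by linarith)
  have hceil : Real.log ‖v‖ ≤ Real.log M * n := by
    rw [mul_comm, ← div_le_iff₀ hlogM]
    exact Nat.le_ceil _
  calc ENNReal.ofReal (Real.log (‖v‖ + 1))
      ≤ ENNReal.ofReal (Real.log 2 + Real.log M * n) := ENNReal.ofReal_le_ofReal (by linarith)
    _ ≤ ENNReal.ofReal (Real.log 2) + ENNReal.ofReal (Real.log M) * n := by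
        refine ENNReal.ofReal_add_le.trans ?_
        rw [ENNReal.ofReal_mul hlogM.le, ENNReal.ofReal_natCast]
    _ ≤ _ := by gcongr

theorem exists_affine_orbit (φ : E ≃L[ℝ] E) (u y : E) :
    ∃ w : ℤ → E, w 0 = y ∧ ∀ k : ℤ, w k = u + φ (w (k - 1)) := by
  -- As φ is invertible, v ↦ u + φ(v) is a permutation, and its integer powers give a two-sided
  -- orbit.
  set A : Equiv.Perm E := φ.toEquiv.trans (Equiv.addLeft u)
  refine ⟨fun k => (A ^ k) y, by simp, fun k => ?_⟩
  calc (A ^ k) y = (A ^ (1 + (k - 1))) y := by congr 2; ring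
    _ = A ((A ^ (k - 1)) y) := by rw [zpow_add, zpow_one]; rfl
    _ = _ := rfl

theorem affine_orbit_natCast {φ : E ≃L[ℝ] E} {u : E} {w : ℤ → E}
    (hw : ∀ k : ℤ, w k = u + φ (w (k - 1))) (n : ℕ) :
    w n = ∑ i ∈ Finset.range n, ((φ : E →L[ℝ] E) ^ i) u + ((φ : E →L[ℝ] E) ^ n) (w 0) := by
  induction n with
  | zero => simp
  | succ n ih =>
    have hφ : φ (w n) = (φ : E →L[ℝ] E) (w n) := rfl
    rw [hw]
    simp only [Nat.cast_succ, add_sub_cancel_right]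
    rw [hφ, ih, map_add, map_sum, Finset.sum_range_succ', ← add_assoc, add_comm u]
    simp [pow_succ']

variable [MeasurableSpace E]

theorem ae_mem_contractionSubspace {T : E →L[ℝ] E} {μ : Measure E} {u : E}
    (h : ∀ m : ℕ, ∑' i : ℕ, μ {x | 1 / ((m : ℝ) + 1) < ‖(T ^ i) (x - u)‖} ≠ ∞) :
    ∀ᵐ x ∂μ, x - u ∈ contractionSubspace T := by
  filter_upwards [ae_all_iff.2 fun m => ae_eventually_notMem (h m)] with x hx
  change Tendsto (fun n : ℕ => (T ^ n) (x - u)) atTop (𝓝 0)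
  rw [Metric.tendsto_atTop']
  intro ε hε
  obtain ⟨m, hm⟩ := exists_nat_one_div_lt hε
  obtain ⟨N, hN⟩ := eventually_atTop.1 (hx m)
  refine ⟨N, fun n hn => ?_⟩
  rw [dist_zero_right]
  have h₁ := hN n hn.le
  exact (not_lt.1 h₁).trans_lt hm

end Linear

/-! ### Effect of translations on laws and logarithmic moments -/

section Translation

variable {E : Type*} [NormedAddCommGroup E] [MeasurableSpace E]

theorem lintegral_log_norm_add_one_lt_top_of_sub {μ : Measure E} [IsProbabilityMeasure μ] (u : E)
    (h : ∫⁻ x, ENNReal.ofReal (Real.log (‖x - u‖ + 1)) ∂μ < ∞) :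
    ∫⁻ x, ENNReal.ofReal (Real.log (‖x‖ + 1)) ∂μ < ∞ := by
  have hle (x : E) : ENNReal.ofReal (Real.log (‖x‖ + 1))
      ≤ ENNReal.ofReal (Real.log (‖x - u‖ + 1)) + ENNReal.ofReal (Real.log (‖u‖ + 1)) := by
    rw [← ENNReal.ofReal_add (Real.log_nonneg (by linarith [norm_nonneg (x - u)]))
      (Real.log_nonneg (by linarith [norm_nonneg u])),
      ← Real.log_mul (by positivity) (by positivity)]
    refine ENNReal.ofReal_le_ofReal (Real.log_le_log (by positivity) ?_)
    have h₁ : ‖x‖ ≤ ‖x - u‖ + ‖u‖ := by simpa using norm_add_le (x - u) u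
    nlinarith [norm_nonneg (x - u), norm_nonneg u]
  refine (lintegral_mono hle).trans_lt ?_
  rw [lintegral_add_right _ measurable_const, ENNReal.add_lt_top]
  simpa using h

variable [BorelSpace E] [SecondCountableTopology E]

theorem map_conv_delta_eq (μ : ProbabilityMeasure E) (x : E) :
    (conv μ (delta x) : Measure E) = Measure.map (fun v => v + x) μ :=
  Measure.conv_dirac _ _

theorem conv_delta_neg_conv_delta (ρ : ProbabilityMeasure E) (x : E) :
    conv (conv ρ (delta (-x))) (delta x) = ρ := by
  rw [conv_assoc, conv_delta_delta, neg_add_cancel, conv_delta_zero]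

theorem lintegral_log_conv_delta_lt_top {μ : ProbabilityMeasure E} (u : E)
    (h : ∫⁻ v, ENNReal.ofReal (Real.log (‖v‖ + 1)) ∂(μ : Measure E) < ∞) :
    ∫⁻ v, ENNReal.ofReal (Real.log (‖v‖ + 1)) ∂(conv μ (delta u) : Measure E) < ∞ := by
  refine lintegral_log_norm_add_one_lt_top_of_sub u ?_
  rw [map_conv_delta_eq, lintegral_map (by fun_prop) (by fun_prop)]
  simpa using h

end Translation

/-! ### A solution forces the coset and moment conditions -/

section Necessity

variable {E : Type*} [NormedAddCommGroup E] [NormedSpace ℝ E] [MeasurableSpace E] [BorelSpace E]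

theorem measurableSet_pow_norm_gt (T : E →L[ℝ] E) (r : ℝ) (i : ℕ) :
    MeasurableSet {v : E | r < ‖(T ^ i) v‖} :=
  measurableSet_lt measurable_const (T ^ i).measurable.norm

theorem lintegral_log_norm_sub_lt_top (φ : E ≃L[ℝ] E) {μ : Measure E} [IsProbabilityMeasure μ]
    {u : E} (h : ∑' i : ℕ, μ {x | 1 < ‖((φ : E →L[ℝ] E) ^ i) (x - u)‖} ≠ ∞) :
    ∫⁻ x, ENNReal.ofReal (Real.log (‖x - u‖ + 1)) ∂μ < ∞ := by
  obtain ⟨c, hc, hle⟩ := ofReal_log_norm_le_tsum φ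
  have hmeas (i : ℕ) : MeasurableSet {x | 1 < ‖((φ : E →L[ℝ] E) ^ i) (x - u)‖} :=
    (measurable_sub_const u) (measurableSet_pow_norm_gt (φ : E →L[ℝ] E) 1 i)
  have hmeas' (i : ℕ) : Measurable fun x : E =>
      ({v | 1 < ‖((φ : E →L[ℝ] E) ^ i) v‖} : Set E).indicator (1 : E → ℝ≥0∞) (x - u) :=
    (measurable_one.indicator (measurableSet_pow_norm_gt _ 1 i)).comp (measurable_sub_const u)
  refine (lintegral_mono fun x => hle (x - u)).trans_lt ?_
  rw [lintegral_add_left measurable_const, lintegral_const_mul _ (Measurable.tsum hmeas'),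
    lintegral_tsum fun i => (hmeas' i).aemeasurable]
  have hi (i : ℕ) : ∫⁻ x, ({v | 1 < ‖((φ : E →L[ℝ] E) ^ i) v‖} : Set E).indicator
      (1 : E → ℝ≥0∞) (x - u) ∂μ = μ {x | 1 < ‖((φ : E →L[ℝ] E) ^ i) (x - u)‖} := by
    rw [← lintegral_indicator_one (hmeas i)]
    rfl
  simp only [hi, lintegral_const, measure_univ, mul_one, ENNReal.add_lt_top, ENNReal.ofReal_lt_top,
    true_and]
  exact ENNReal.mul_lt_top hc.lt_top h.lt_top

variable [SecondCountableTopology E]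

/-- A large norm forces one of finitely many coordinate functionals to be large, so a union bound
reduces to one-dimensional tails. -/
theorem tsum_symmetrization_norm_gt_ne_top [FiniteDimensional ℝ E] {T : E →L[ℝ] E}
    {μ γ : ProbabilityMeasure E} {β : ℕ → ProbabilityMeasure E}
    (h : ∀ n, conv (convProd T μ n) (β n) = γ) {r : ℝ} (hr : 0 < r) :
    ∑' i : ℕ, (symmetrization μ : Measure E) {x | r < ‖(T ^ i) x‖} ≠ ∞ := by
  obtain ⟨s, L, hs, hL⟩ := exists_dual_family_norm_gt (E := E) r hr
  have hfin (j) : ∑' i : ℕ, (symmetrization μ : Measure E) {x | s < |L j ((T ^ i) x)|} ≠ ∞ := by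
    obtain ⟨C, hC⟩ := exists_sum_symmetrization_dual_gt_le h (L j) hs
    refine ne_top_of_le_ne_top (b := ENNReal.ofReal C) ENNReal.ofReal_ne_top ?_
    rw [ENNReal.tsum_eq_iSup_nat]
    refine iSup_le fun n => ?_
    refine le_trans (le_of_eq ?_) (ENNReal.ofReal_le_ofReal (hC n))
    rw [ENNReal.ofReal_sum_of_nonneg fun _ _ => measureReal_nonneg]
    exact Finset.sum_congr rfl fun i _ => (ofReal_measureReal).symm
  refine ne_top_of_le_ne_top (b := ∑ j, ∑' i : ℕ,
    (symmetrization μ : Measure E) {x | s < |L j ((T ^ i) x)|}) ?_ ?_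
  · exact ENNReal.sum_ne_top.2 fun j _ => hfin j
  · rw [← Summable.tsum_finsetSum fun _ _ => ENNReal.summable]
    refine ENNReal.tsum_le_tsum fun i => ?_
    refine (measure_mono fun x hx => ?_).trans (measure_iUnion_fintype_le _
      fun j => {x | s < |L j ((T ^ i) x)|})
    exact Set.mem_iUnion.2 (hL _ hx)

/-- If all the convolution products `∏_{i ≤ n} T^{i-1}(μ)` are factors of one measure, then for
some centering `u` the sets `{‖T^i (x - u)‖ > r}` have summable mass. -/
theorem exists_tsum_norm_gt_ne_top [FiniteDimensional ℝ E] {T : E →L[ℝ] E}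
    {μ γ : ProbabilityMeasure E} {β : ℕ → ProbabilityMeasure E}
    (h : ∀ n, conv (convProd T μ n) (β n) = γ) :
    ∃ u : E, ∀ m : ℕ, ∑' i : ℕ,
      (μ : Measure E) {x | 1 / ((m : ℝ) + 1) < ‖(T ^ i) (x - u)‖} ≠ ∞ := by
  -- The symmetrized mass is the average over u ~ μ of the mass centered at u, so a finite sum of
  -- averages leaves the sum finite for almost every u, for all m at once.
  have hae : ∀ᵐ u ∂(μ : Measure E), ∀ m : ℕ, ∑' i : ℕ,
      (μ : Measure E) {x | 1 / ((m : ℝ) + 1) < ‖(T ^ i) (x - u)‖} < ∞ := by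
    refine ae_all_iff.2 fun m => ?_
    have hm := tsum_symmetrization_norm_gt_ne_top h (r := 1 / ((m : ℝ) + 1)) (by positivity)
    have hmeas (i : ℕ) : Measurable fun u : E =>
        (μ : Measure E) {x | 1 / ((m : ℝ) + 1) < ‖(T ^ i) (x - u)‖} :=
      measurable_measure_prodMk_right
        (measurable_sub (measurableSet_pow_norm_gt T (1 / ((m : ℝ) + 1)) i))
    simp only [symmetrization_apply μ (measurableSet_pow_norm_gt T (1 / ((m : ℝ) + 1)) _)] at hm
    simp only [Set.mem_ofPred_eq] at hm
    rw [← lintegral_tsum fun i => (hmeas i).aemeasurable] at hm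
    exact ae_lt_top (Measurable.tsum hmeas) hm
  obtain ⟨u, hu⟩ := hae.exists
  exact ⟨u, fun m => (hu m).ne⟩

theorem exists_cosetAndLogMoment_of_isSolution [FiniteDimensional ℝ E] {φ : E ≃L[ℝ] E}
    {μ : ProbabilityMeasure E} {lam : ℤ → ProbabilityMeasure E}
    (h : IsSolution φ (fun _ => μ) lam) :
    ∃ u : E, CosetAndLogMoment (φ : E →L[ℝ] E) μ u := by
  obtain ⟨u, hu⟩ := exists_tsum_norm_gt_ne_top fun n => (eq_convProd_conv_push h 0 n).symm
  refine ⟨u, ?_, ?_⟩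
  · rw [← prob_compl_eq_zero_iff]
    · filter_upwards [ae_mem_contractionSubspace hu] with x hx
      exact ⟨x - u, hx, by simp⟩
    · exact ((contractionSubspace (φ : E →L[ℝ] E)).closed_of_finiteDimensional.vadd u).measurableSet
  · refine lintegral_log_norm_add_one_lt_top_of_sub u (lintegral_log_norm_sub_lt_top φ ?_)
    -- The threshold m = 0 is the radius 1 used in the counting bound.
    simpa using hu 0

end Necessity

/-! ### Construction and fundamentality of the shifted solutions -/

section Sufficiency

variable {E : Type*} [NormedAddCommGroup E] [NormedSpace ℝ E] [MeasurableSpace E] [BorelSpace E]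
  [SecondCountableTopology E]

theorem ae_mem_contractionSubspace_of_cosetAndLogMoment [FiniteDimensional ℝ E] {T : E →L[ℝ] E}
    {μ : ProbabilityMeasure E} {u : E} (h : CosetAndLogMoment T μ u) :
    ∀ᵐ v ∂(conv μ (delta (-u)) : Measure E), v ∈ contractionSubspace T := by
  have hcl := (contractionSubspace T).closed_of_finiteDimensional
  rw [map_conv_delta_eq]
  refine (ae_map_iff (by fun_prop) hcl.measurableSet).2 ?_
  have h₁ := (prob_compl_eq_zero_iff (hcl.vadd u).measurableSet).2 h.1
  filter_upwards [measure_eq_zero_iff_ae_notMem.1 h₁] with x hx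
  obtain ⟨y, hy, rfl⟩ := not_not.1 hx
  simpa using! hy

theorem delta_affine_orbit {φ : E ≃L[ℝ] E} {u : E} {w : ℤ → E}
    (hw : ∀ k : ℤ, w k = u + φ (w (k - 1))) (k : ℤ) :
    delta (w k) = conv (delta u) (push (φ : E →L[ℝ] E) (delta (w (k - 1)))) := by
  rw [push_delta, conv_delta_delta, hw k]
  rfl

/-- Every solution for the co-factor `σ` factors through the limit of the convolution products. -/
theorem exists_eq_conv_push_zpow [FiniteDimensional ℝ E] {φ : E ≃L[ℝ] E}
    {σ ν : ProbabilityMeasure E} (hν : Tendsto (convProd (φ : E →L[ℝ] E) σ) atTop (𝓝 ν))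
    {lam : ℤ → ProbabilityMeasure E} (h : IsSolution φ (fun _ => σ) lam) :
    ∃ ρ : ProbabilityMeasure E, ∀ k : ℤ,
      lam k = conv ν (push ((φ ^ k : E ≃L[ℝ] E) : E →L[ℝ] E) ρ) := by
  have : CompleteSpace E := FiniteDimensional.complete ℝ E
  set b : ℕ → ProbabilityMeasure E := fun n => push ((φ : E →L[ℝ] E) ^ n) (lam (-n))
  have hb : ∀ n, conv (convProd (φ : E →L[ℝ] E) σ n) (b n) = lam 0 := fun n => by
    simpa using (eq_convProd_conv_push h 0 n).symm
  have hcomp := isCompact_closure_of_isTightMeasureSet (isTightMeasureSet_of_conv_eq hν hb)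
  obtain ⟨ρ, -, hρ⟩ := hcomp.exists_mapClusterPt (f := atTop) (u := b)
    (tendsto_principal.2 (Eventually.of_forall fun n => subset_closure ⟨n, rfl⟩))
  -- A single ultrafilter, fixed before k, makes the same ρ serve every k.
  obtain ⟨U, hU, hUρ⟩ := mapClusterPt_iff_ultrafilter.1 hρ
  refine ⟨ρ, fun k => ?_⟩
  -- Unrolling n + k steps from time k ends at time -n for every k; truncation by `toNat` is
  -- harmless once n ≥ -k.
  have hlam : ∀ᶠ n : ℕ in U, conv (convProd (φ : E →L[ℝ] E) σ (n + k).toNat)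
      (push ((φ ^ k : E ≃L[ℝ] E) : E →L[ℝ] E) (b n)) = lam k := by
    filter_upwards [hU (eventually_ge_atTop (-k).toNat)] with n hn
    have hnk : ((n + k).toNat : ℤ) = n + k := Int.toNat_of_nonneg (by omega)
    rw [eq_convProd_conv_push h k (n + k).toNat, hnk, push_push]
    have hpow : ((φ ^ k : E ≃L[ℝ] E) : E →L[ℝ] E) * (φ : E →L[ℝ] E) ^ n
        = (φ : E →L[ℝ] E) ^ (n + k).toNat := by
      have hcoe (m : ℕ) : (φ : E →L[ℝ] E) ^ m = ((φ ^ m : E ≃L[ℝ] E) : E →L[ℝ] E) := by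
        induction m with
        | zero => rfl
        | succ m ih => rw [pow_succ, pow_succ, ih]; rfl
      rw [hcoe, hcoe]
      have : φ ^ (n + k).toNat = φ ^ k * φ ^ n := by
        rw [← zpow_natCast, ← zpow_natCast, ← zpow_add, hnk, add_comm]
      rw [this]
      rfl
    rw [hpow]
    congr 3
    ring
  have hnk : Tendsto (fun n : ℕ => (n + k).toNat) atTop atTop := by
    refine tendsto_atTop.2 fun m => ?_
    filter_upwards [eventually_ge_atTop (m + (-k).toNat)] with n hn
    omega
  have hlim := tendsto_conv ((hν.comp hnk).mono_left hU)
    (tendsto_push ((φ ^ k : E ≃L[ℝ] E) : E →L[ℝ] E) hUρ)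
  exact tendsto_nhds_unique (tendsto_const_nhds.congr' (hlam.mono fun _ hn => hn.symm)) hlim

/-- Convolving with δ at -w k turns solutions for μ into solutions for μ * δ_{-u}, where the
constant sequence ν is already fundamental. -/
theorem isFundamentalSolution_conv_delta [FiniteDimensional ℝ E] {φ : E ≃L[ℝ] E}
    {μ ν : ProbabilityMeasure E} {u : E}
    (hν : Tendsto (convProd (φ : E →L[ℝ] E) (conv μ (delta (-u)))) atTop (𝓝 ν))
    {w : ℤ → E} (hw : ∀ k : ℤ, w k = u + φ (w (k - 1))) :
    IsFundamentalSolution φ (fun _ => μ) (fun k => conv ν (delta (w k))) := by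
  constructor
  · intro k
    change conv ν (delta (w k)) = conv μ (push _ (conv ν (delta (w (k - 1)))))
    conv_lhs => rw [delta_affine_orbit hw k, eq_conv_push_of_tendsto_convProd hν]
    rw [push_conv]
    conv_rhs => rw [← conv_delta_neg_conv_delta μ u]
    ac_rfl
  · intro lam h
    have h' : IsSolution φ (fun _ => conv μ (delta (-u))) fun k => conv (lam k) (delta (-w k)) := by
      have hw' : ∀ k : ℤ, (-w k) = -u + φ (-w (k - 1)) := fun k => by
        rw [hw k, map_neg, neg_add]
      intro k
      change conv (lam k) (delta (-w k))
        = conv (conv μ (delta (-u))) (push _ (conv (lam (k - 1)) (delta (-w (k - 1)))))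
      have hk : lam k = conv μ (push (φ : E →L[ℝ] E) (lam (k - 1))) := h k
      rw [hk, delta_affine_orbit (w := fun k => -w k) hw' k, push_conv]
      ac_rfl
    obtain ⟨ρ, hρ⟩ := exists_eq_conv_push_zpow hν h'
    refine ⟨ρ, fun k => ?_⟩
    change lam k = conv (conv ν (delta (w k))) _
    rw [← conv_delta_neg_conv_delta (lam k) (w k), hρ k]
    ac_rfl

/-- Centering each factor by u shifts the product by -∑ φ^i(u), which differs from -w n only by
φ^n(w 0) → 0. -/
theorem tendsto_convProd_conv_delta_neg {φ : E ≃L[ℝ] E} {μ ν : ProbabilityMeasure E} {u : E}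
    (hν : Tendsto (convProd (φ : E →L[ℝ] E) (conv μ (delta (-u)))) atTop (𝓝 ν))
    {w : ℤ → E} (hw : ∀ k : ℤ, w k = u + φ (w (k - 1)))
    (hw0 : w 0 ∈ contractionSubspace (φ : E →L[ℝ] E)) :
    Tendsto (fun n : ℕ => conv (convProd (φ : E →L[ℝ] E) μ n) (delta (-(w n)))) atTop (𝓝 ν) := by
  have h₀ : Tendsto (fun n : ℕ => -((φ : E →L[ℝ] E) ^ n) (w 0)) atTop (𝓝 0) := by
    simpa using (tendsto_pow_apply_of_mem_contractionSubspace hw0).neg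
  have h := tendsto_conv hν (tendsto_delta h₀)
  rw [conv_delta_zero] at h
  refine h.congr fun n => ?_
  rw [convProd_conv_delta, conv_assoc, conv_delta_delta, affine_orbit_natCast hw n]
  simp [add_comm]

end Sufficiency

end ConvEq

/-! ### The main theorem -/

theorem mainTheorem3 (d : ℕ)
    (φ : EuclideanSpace ℝ (Fin d) ≃L[ℝ] EuclideanSpace ℝ (Fin d))
    (μ : ProbabilityMeasure (EuclideanSpace ℝ (Fin d))) :
    [ ∃ lam : ℤ → ProbabilityMeasure (EuclideanSpace ℝ (Fin d)),
        ConvEq.IsSolution φ (fun _ => μ) lam,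
      ∃ lam : ℤ → ProbabilityMeasure (EuclideanSpace ℝ (Fin d)),
        ConvEq.IsFundamentalSolution φ (fun _ => μ) lam,
      ∃ u : EuclideanSpace ℝ (Fin d), ConvEq.CosetAndLogMoment φ μ u ].TFAE ∧
    ∀ u : EuclideanSpace ℝ (Fin d), ConvEq.CosetAndLogMoment φ μ u →
      (∀ y : EuclideanSpace ℝ (Fin d), ∃ w : ℤ → EuclideanSpace ℝ (Fin d),
        w 0 = y ∧ ∀ k : ℤ, w k = u + φ (w (k - 1))) ∧
      ∃ ν : ProbabilityMeasure (EuclideanSpace ℝ (Fin d)),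
        ConvEq.IsStronglyDecomposable φ (ConvEq.conv μ (ConvEq.delta (-u))) ν ∧
        (∀ ν' : ProbabilityMeasure (EuclideanSpace ℝ (Fin d)),
          ConvEq.IsStronglyDecomposable φ (ConvEq.conv μ (ConvEq.delta (-u))) ν' → ν' = ν) ∧
        Tendsto (fun n : ℕ => ConvEq.convProd φ (ConvEq.conv μ (ConvEq.delta (-u))) n)
          atTop (𝓝 ν) ∧
        ∀ w : ℤ → EuclideanSpace ℝ (Fin d), (∀ k : ℤ, w k = u + φ (w (k - 1))) →
          ConvEq.IsFundamentalSolution φ (fun _ => μ)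
            (fun k => ConvEq.conv ν (ConvEq.delta (w k))) ∧
          (w 0 ∈ ConvEq.contractionSubspace (φ : EuclideanSpace ℝ (Fin d) →L[ℝ] _) →
            Tendsto (fun n : ℕ => ConvEq.conv (ConvEq.convProd φ μ n) (ConvEq.delta (-(w n))))
              atTop (𝓝 ν)) := by
  have key (u : EuclideanSpace ℝ (Fin d)) (hu : ConvEq.CosetAndLogMoment φ μ u) :=
    ConvEq.exists_tendsto_convProd
      (ConvEq.ae_mem_contractionSubspace_of_cosetAndLogMoment hu)
      (ConvEq.lintegral_log_conv_delta_lt_top (-u) hu.2)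
  refine ⟨?_, fun u hu => ⟨ConvEq.exists_affine_orbit φ u, ?_⟩⟩
  · tfae_have 1 → 3 := fun ⟨_, h⟩ => ConvEq.exists_cosetAndLogMoment_of_isSolution h
    tfae_have 2 → 1 := fun ⟨lam, h⟩ => ⟨lam, h.1⟩
    tfae_have 3 → 2 := fun ⟨u, hu⟩ => by
      obtain ⟨_, hν, -⟩ := key u hu
      obtain ⟨_, -, hw⟩ := ConvEq.exists_affine_orbit φ u 0
      exact ⟨_, ConvEq.isFundamentalSolution_conv_delta hν hw⟩
    tfae_finish
  · obtain ⟨ν, hν, hdec⟩ := key u hu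
    exact ⟨ν, hdec, fun _ h => ConvEq.eq_of_isStronglyDecomposable hν h, hν,
      fun _ hw => ⟨ConvEq.isFundamentalSolution_conv_delta hν hw,
        ConvEq.tendsto_convProd_conv_delta_neg hν hw⟩⟩
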